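/- Let $(X_t)_{t\ge 0}$ be a continuous-time Markov chain with right-continuous paths on a finite state space $\mathcal S$, with irreducible generator $Q$ (so that its transition probabilities are $\mathrm P_i[X_t=j]=(e^{Qt})_{ij}$) and stationary probability vector $\pi$. Write $\mathrm E_i$ for the expectation given $X_0=i$, and put $\theta_j=\inf\{t\ge 0: X_t=j\}$ (first hitting time of $j$) and $M_j(t)=\int_0^t \mathbf 1\{X_u=j\}\,du$ (total time spent in $j$ until time $t$). Then $\mathrm E_i[\theta_j]<\infty$ for all $i,j\in\mathcal S$, and $$\pi_j\,\mathrm E_i[\theta_j]=\lim_{t\to\infty}\bigl(\mathrm E_j[M_j(t)]-\mathrm E_i[M_j(t)]\bigr)\qquad\text{for all } i,j\in\mathcal S.$$ Consequently, for every $i\in\mathcal S$, $$\sum_{j\in\mathcal S}\pi_j\,\mathrm E_i[\theta_j]=\lim_{t\to\infty}\Bigl(\sum_{j\in\mathcal S}\mathrm E_j[M_j(t)]-t\Bigr),$$ so that the left-hand side does not depend on $i$. Moreover the deviation matrix $\mathcal D=\int_0^\infty\bigl(e^{Qt}-\mathbf 1\pi^{\mathsf T}\bigr)\,dt$ converges absolutely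 (entrywise), and for every $i\in\mathcal S$ $$\sum_{j\in\mathcal S}\pi_j\,\mathrm E_i[\theta_j]=\sum_{j\in\mathcal S}\mathcal D_{jj}.$$ -/

import Mathlib

open MeasureTheory Filter Topology
open scoped NNReal ENNReal Matrix

/-- The generator (rate matrix) of a continuous-time Markov chain on a finite set: nonnegative
off-diagonal entries and zero row sums. -/
structure IsGenerator {S : Type*} [Fintype S] (Q : Matrix S S ℝ) : Prop where
  off_diag_nonneg : ∀ i j, i ≠ j → 0 ≤ Q i j
  row_sum : ∀ i, ∑ j, Q i j = 0

/-- Irreducibility: any state is reached from any other along transitions of positive rate. -/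
def IsIrreducibleGenerator {S : Type*} (Q : Matrix S S ℝ) : Prop :=
  ∀ i j, Relation.ReflTransGen (fun a b => a ≠ b ∧ 0 < Q a b) i j

/-- The transition matrix `e ^ (Q t)` over a time span `t`. -/
noncomputable def transitionMatrix {S : Type*} [Fintype S] [DecidableEq S]
    (Q : Matrix S S ℝ) (t : ℝ) : Matrix S S ℝ :=
  NormedSpace.exp (t • Q)

/-- `π` is a stationary distribution: a probability vector with `πᵀ e ^ (Q t) = πᵀ` for all
`t ≥ 0`. -/
structure IsStationaryDistribution {S : Type*} [Fintype S] [DecidableEq S]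
    (Q : Matrix S S ℝ) (π : S → ℝ) : Prop where
  nonneg : ∀ j, 0 ≤ π j
  sum_eq_one : ∑ j, π j = 1
  invariant : ∀ t : ℝ, 0 ≤ t → π ᵥ* transitionMatrix Q t = π

/-- `X` is a continuous-time Markov chain with generator `Q`, and `P i` is the law under which it
starts in `i`: the paths are right-continuous for the discrete topology, and given the states at
times `t 0 ≤ ⋯ ≤ t n`, the state at time `t n + u` is distributed according to the row of
`e ^ (Q u)` of the state at time `t n`. -/
structure IsMarkovChain {S Ω : Type*} [Fintype S] [DecidableEq S] [MeasurableSpace Ω]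
    (Q : Matrix S S ℝ) (X : ℝ≥0 → Ω → S) (P : S → Measure Ω) : Prop where
  isProbabilityMeasure : ∀ i, IsProbabilityMeasure (P i)
  measurableSet_eq : ∀ t j, MeasurableSet {ω | X t ω = j}
  right_continuous : ∀ ω t, ∀ᶠ u in 𝓝[≥] t, X u ω = X t ω
  initial : ∀ i, P i {ω | X 0 ω = i} = 1
  markov : ∀ (i : S) (n : ℕ) (t : Fin (n + 1) → ℝ≥0) (s : Fin (n + 1) → S) (u : ℝ≥0) (k : S),
    Monotone t →
      (P i).real {ω | (∀ m, X (t m) ω = s m) ∧ X (t (Fin.last n) + u) ω = k} =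
        (P i).real {ω | ∀ m, X (t m) ω = s m} * transitionMatrix Q u (s (Fin.last n)) k

/-- The first hitting time `θ_j = inf {t ≥ 0 : X_t = j}`, equal to `∞` if `j` is never visited. -/
noncomputable def hitTime {S Ω : Type*} (X : ℝ≥0 → Ω → S) (j : S) (ω : Ω) : ℝ≥0∞ :=
  ⨅ (t : ℝ≥0) (_ : X t ω = j), (t : ℝ≥0∞)

/-- The total time `M_j(t) = ∫₀ᵗ 1{X(u) = j} du` spent in `j` until time `t`. -/
noncomputable def occupationTime {S Ω : Type*} [DecidableEq S]
    (X : ℝ≥0 → Ω → S) (j : S) (t : ℝ) (ω : Ω) : ℝ :=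
  ∫ u in (0 : ℝ)..t, if X u.toNNReal ω = j then (1 : ℝ) else 0

/-- The deviation matrix `∫₀^∞ (e ^ (Q t) - 1 πᵀ) dt`, with the integral taken entrywise. -/
noncomputable def deviationMatrix {S : Type*} [Fintype S] [DecidableEq S]
    (Q : Matrix S S ℝ) (π : S → ℝ) : Matrix S S ℝ :=
  Matrix.of fun i j =>
    ∫ t in Set.Ioi (0 : ℝ), (transitionMatrix Q t - Matrix.vecMulVec (1 : S → ℝ) π) i j

/-! Everything follows from `π j * E_i[θ_j] = D j j - D i j`, where `D` is the deviation matrix. For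
`δ ≥ 0`, `e ^ (Qδ) D` is the integral defining `D` started at `δ` (`deviationMatrix_sub`). So `f l =
D j j - D l j` vanishes at `j`, and over a time step `δ` it drops on average by `π j * δ` minus the
expected time spent in `j` (`deviationMatrix_drift`). From `l ≠ j` that expected time is `o(δ)`.
Telescoping along the grid `δℕ` until `j` is hit (`summable_skeletonAvoids_of_drift`) puts `f i`
between `(π j - η) E` and `π j E`, with `E` the expected grid hitting time. Along `δ = 2⁻ⁿ` grid
hitting times decrease to `θ_j` by right-continuity, which gives the identity (`lintegral_hitTime`).
By Fubini, `E_i[M_j(t)] = t * π j + ∫₀ᵗ (e ^ (Qu) - 1 πᵀ) i j du`, so differences of expected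
occupation times tend to the same value. Summing over `j` leaves the trace, because the rows of `D`
sum to zero. Doeblin's contraction gives absolute convergence of `D`. -/

/-! ### Positivity and ergodicity of the semigroup; the deviation matrix. -/

section MatrixSemigroup

variable {S : Type*} [Fintype S] [DecidableEq S] {Q : Matrix S S ℝ} {π : S → ℝ}

lemma transitionMatrix_zero (Q : Matrix S S ℝ) : transitionMatrix Q 0 = 1 := by
  simp [transitionMatrix]

lemma transitionMatrix_add (Q : Matrix S S ℝ) (s t : ℝ) :
    transitionMatrix Q (s + t) = transitionMatrix Q s * transitionMatrix Q t := by
  simp only [transitionMatrix, add_smul]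
  exact Matrix.exp_add_of_commute _ _ (((Commute.refl Q).smul_left s).smul_right t)

open scoped Matrix.Norms.Operator in
lemma hasDerivAt_transitionMatrix (Q : Matrix S S ℝ) (t : ℝ) :
    HasDerivAt (transitionMatrix Q) (transitionMatrix Q t * Q) t :=
  hasDerivAt_exp_smul_const Q t

open scoped Matrix.Norms.Operator in
lemma continuous_transitionMatrix (Q : Matrix S S ℝ) : Continuous (transitionMatrix Q) :=
  continuous_iff_continuousAt.2 fun t => (hasDerivAt_transitionMatrix Q t).continuousAt

lemma continuous_transitionMatrix_apply (Q : Matrix S S ℝ) (i j : S) :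
    Continuous fun t => transitionMatrix Q t i j :=
  (continuous_transitionMatrix Q).matrix_elem i j

open scoped Matrix.Norms.Operator in
lemma hasDerivAt_transitionMatrix_apply_zero (Q : Matrix S S ℝ) (i j : S) :
    HasDerivAt (fun t => transitionMatrix Q t i j) (Q i j) 0 := by
  have h := hasDerivAt_transitionMatrix Q 0
  rw [transitionMatrix_zero, one_mul] at h
  exact ((Matrix.entryLinearMap ℝ ℝ i j).toContinuousLinearMap.hasFDerivAt.comp_hasDerivAt 0 h)

lemma transitionMatrix_apply_add (Q : Matrix S S ℝ) (s t : ℝ) (i k : S) :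
    transitionMatrix Q (s + t) i k =
      ∑ j, transitionMatrix Q s i j * transitionMatrix Q t j k := by
  rw [transitionMatrix_add, Matrix.mul_apply]

/-- The matrices `e ^ (Q t)`, `t ≥ 0`, are stochastic. -/
def IsStochasticSemigroup (Q : Matrix S S ℝ) : Prop :=
  ∀ t : ℝ, 0 ≤ t → ∀ i, (∀ j, 0 ≤ transitionMatrix Q t i j) ∧ ∑ j, transitionMatrix Q t i j = 1

namespace IsStochasticSemigroup

variable (hP : IsStochasticSemigroup Q)
include hP

lemma mul_le_apply_add {s t : ℝ} (hs : 0 ≤ s) (ht : 0 ≤ t) (i j k : S) :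
    transitionMatrix Q s i j * transitionMatrix Q t j k ≤ transitionMatrix Q (s + t) i k := by
  rw [transitionMatrix_apply_add]
  exact Finset.single_le_sum
    (f := fun j => transitionMatrix Q s i j * transitionMatrix Q t j k)
    (fun l _ => mul_nonneg ((hP s hs i).1 l) ((hP t ht l).1 k)) (Finset.mem_univ j)

/-- Continuity at `0` gives positivity over a short span `t / (n + 1)`; chaining `n + 1` such spans
reaches `t`. -/
lemma diag_pos {t : ℝ} (ht : 0 < t) (i : S) : 0 < transitionMatrix Q t i i := by
  have h0 : ∀ᶠ s in 𝓝 (0 : ℝ), 0 < transitionMatrix Q s i i := by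
    have := (continuous_transitionMatrix_apply Q i i).tendsto 0
    rw [transitionMatrix_zero, Matrix.one_apply_eq] at this
    exact this.eventually_const_lt one_pos
  have h1 : Tendsto (fun n : ℕ => t / (n + 1)) atTop (𝓝 0) := by
    simpa [div_eq_mul_inv] using
      (tendsto_one_div_add_atTop_nhds_zero_nat (𝕜 := ℝ)).const_mul t
  obtain ⟨n, hn⟩ := (h1.eventually h0).exists
  have h2 : ∀ m : ℕ, 0 < transitionMatrix Q ((m + 1) * (t / (n + 1))) i i := by
    intro m
    induction m with
    | zero => simpa using hn
    | succ m ih =>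
      have := hP.mul_le_apply_add (s := (m + 1) * (t / (n + 1))) (t := t / (n + 1))
        (by positivity) (by positivity) i i i
      refine (mul_pos ih hn).trans_le (this.trans_eq ?_)
      congr 1
      push_cast
      ring_nf
  have := h2 n
  rwa [mul_div_cancel₀ _ (by positivity)] at this

/-- The derivative at `0` is `Q i j > 0`, so a jump within some short time `s < t` has positive
probability; the remaining time is spent returning to `j`. -/
lemma pos_of_rate_pos {t : ℝ} (ht : 0 < t) {i j : S} (hij : i ≠ j) (hQ : 0 < Q i j) :
    0 < transitionMatrix Q t i j := by
  have h1 := (hasDerivAt_transitionMatrix_apply_zero Q i j).tendsto_slope_zero_right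
  have h2 : ∀ᶠ s in 𝓝[>] (0 : ℝ), 0 < transitionMatrix Q s i j := by
    filter_upwards [h1.eventually_const_lt hQ, self_mem_nhdsWithin] with s hs hs0
    rw [transitionMatrix_zero, Matrix.one_apply_ne hij, zero_add, sub_zero, smul_eq_mul] at hs
    exact (mul_pos_iff_of_pos_left (inv_pos.2 hs0)).1 hs
  obtain ⟨s, hs, hs0, hst⟩ := (h2.and (Ioo_mem_nhdsGT ht)).exists
  have := hP.mul_le_apply_add hs0.le (sub_pos.2 hst).le i j j
  rw [add_sub_cancel] at this
  exact (mul_pos hs (hP.diag_pos (sub_pos.2 hst) j)).trans_le this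

lemma pos (hirr : IsIrreducibleGenerator Q) {t : ℝ} (ht : 0 < t) (i j : S) :
    0 < transitionMatrix Q t i j := by
  have h := hirr i j
  induction h generalizing t with
  | refl => exact hP.diag_pos ht i
  | @tail b c _ hbc ih =>
    have := hP.mul_le_apply_add (half_pos ht).le (half_pos ht).le i b c
    rw [add_halves] at this
    exact (mul_pos (ih (half_pos ht)) (hP.pos_of_rate_pos (half_pos ht) hbc.1 hbc.2)).trans_le this

lemma stationary_pos (hirr : IsIrreducibleGenerator Q) (hπ : IsStationaryDistribution Q π) (j : S) :
    0 < π j := by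
  rw [← hπ.invariant 1 zero_le_one]
  have hpos : ∃ i, π i ≠ 0 := by
    by_contra! h
    simpa [h] using hπ.sum_eq_one
  obtain ⟨i, hi⟩ := hpos
  exact Finset.sum_pos' (fun l _ => mul_nonneg (hπ.nonneg l) (hP.pos hirr one_pos l j).le)
    ⟨i, Finset.mem_univ i, mul_pos ((hπ.nonneg i).lt_of_ne' hi) (hP.pos hirr one_pos i j)⟩

end IsStochasticSemigroup

/-- The deviation `e ^ (Q t) - 1 πᵀ` of the transition matrix from its limit. -/
noncomputable def transitionDeviation (Q : Matrix S S ℝ) (π : S → ℝ) (t : ℝ) : Matrix S S ℝ :=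
  transitionMatrix Q t - Matrix.vecMulVec (1 : S → ℝ) π

lemma transitionDeviation_apply (Q : Matrix S S ℝ) (π : S → ℝ) (t : ℝ) (i j : S) :
    transitionDeviation Q π t i j = transitionMatrix Q t i j - π j := by
  simp [transitionDeviation]

lemma continuous_transitionDeviation_apply (Q : Matrix S S ℝ) (π : S → ℝ) (i j : S) :
    Continuous fun t => transitionDeviation Q π t i j := by
  simp only [transitionDeviation_apply]
  exact (continuous_transitionMatrix_apply Q i j).sub continuous_const

lemma IsStationaryDistribution.sum_mul_apply (hπ : IsStationaryDistribution Q π) {t : ℝ}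
    (ht : 0 ≤ t) (j : S) : ∑ i, π i * transitionMatrix Q t i j = π j :=
  congrFun (hπ.invariant t ht) j

namespace IsStochasticSemigroup

variable (hP : IsStochasticSemigroup Q) (hπ : IsStationaryDistribution Q π)
include hP hπ

lemma sum_deviation_apply {t : ℝ} (ht : 0 ≤ t) (i : S) : ∑ j, transitionDeviation Q π t i j = 0 := by
  simp [transitionDeviation_apply, (hP t ht i).2, hπ.sum_eq_one]

omit hπ in
lemma sum_mul_deviation {s t : ℝ} (hs : 0 ≤ s) (i k : S) :
    ∑ j, transitionMatrix Q s i j * transitionDeviation Q π t j k =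
      transitionDeviation Q π (s + t) i k := by
  simp only [transitionDeviation_apply, mul_sub, Finset.sum_sub_distrib, transitionMatrix_apply_add,
    ← Finset.sum_mul, (hP s hs i).2, one_mul]

omit hP in
lemma sum_deviation_mul {s t : ℝ} (ht : 0 ≤ t) (i k : S) :
    ∑ j, transitionDeviation Q π s i j * transitionMatrix Q t j k =
      transitionDeviation Q π (s + t) i k := by
  simp only [transitionDeviation_apply, sub_mul, Finset.sum_sub_distrib, transitionMatrix_apply_add,
    hπ.sum_mul_apply ht]

lemma sum_abs_deviation_le_two {t : ℝ} (ht : 0 ≤ t) (i : S) :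
    ∑ j, |transitionDeviation Q π t i j| ≤ 2 := by
  calc ∑ j, |transitionDeviation Q π t i j|
      ≤ ∑ j, (transitionMatrix Q t i j + π j) := by
        refine Finset.sum_le_sum fun j _ => ?_
        rw [transitionDeviation_apply]
        refine (abs_sub _ _).trans_eq ?_
        rw [abs_of_nonneg ((hP t ht i).1 j), abs_of_nonneg (hπ.nonneg j)]
    _ = 2 := by rw [Finset.sum_add_distrib, (hP t ht i).2, hπ.sum_eq_one]; norm_num

/-- Doeblin's contraction of the total variation distance to the stationary distribution. -/
lemma exists_contraction (hirr : IsIrreducibleGenerator Q) :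
    ∃ r : ℝ, 0 < r ∧ r < 1 ∧ ∀ t, 0 ≤ t → ∀ i,
      ∑ j, |transitionDeviation Q π (t + 1) i j| ≤ r * ∑ j, |transitionDeviation Q π t i j| := by
  -- A uniform minorization: finitely many entries, all positive. `ε < 1` keeps the ratio `1 - ε`
  -- positive, so that its logarithm can be used later.
  obtain ⟨ε, hε0, hε1, hε⟩ : ∃ ε : ℝ, 0 < ε ∧ ε < 1 ∧ ∀ i j, ε ≤ transitionMatrix Q 1 i j := by
    have : ∀ᶠ ε in 𝓝[>] (0 : ℝ), ∀ i j, ε ≤ transitionMatrix Q 1 i j := by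
      refine eventually_all.2 fun i => eventually_all.2 fun j => ?_
      exact mem_nhdsWithin_of_mem_nhds (Iic_mem_nhds (hP.pos hirr one_pos i j))
    obtain ⟨ε, h, h0, h1⟩ := (this.and (Ioo_mem_nhdsGT one_pos)).exists
    exact ⟨ε, h0, h1, h⟩
  refine ⟨1 - ε, by linarith, by linarith, fun t ht i => ?_⟩
  have hπ1 : ∀ j, π j ≤ 1 := fun j => by
    rw [← hπ.sum_eq_one]
    exact Finset.single_le_sum (fun l _ => hπ.nonneg l) (Finset.mem_univ j)
  have hnn : ∀ j k, 0 ≤ transitionMatrix Q 1 j k - ε * π k := fun j k => by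
    have := mul_le_mul_of_nonneg_left (hπ1 k) hε0.le
    linarith [hε j k]
  -- Subtracting `ε * π k` from the kernel costs nothing, as deviation rows sum to zero; what is
  -- left is nonnegative with row sums `1 - ε`.
  calc ∑ k, |transitionDeviation Q π (t + 1) i k|
      = ∑ k, |∑ j, transitionDeviation Q π t i j * (transitionMatrix Q 1 j k - ε * π k)| := by
        refine Finset.sum_congr rfl fun k _ => ?_
        rw [← sum_deviation_mul hπ zero_le_one]
        simp only [mul_sub, Finset.sum_sub_distrib, ← Finset.sum_mul,
          hP.sum_deviation_apply hπ ht, zero_mul, sub_zero]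
    _ ≤ ∑ k, ∑ j, |transitionDeviation Q π t i j| * (transitionMatrix Q 1 j k - ε * π k) := by
        refine Finset.sum_le_sum fun k _ => (Finset.abs_sum_le_sum_abs _ _).trans_eq ?_
        refine Finset.sum_congr rfl fun j _ => ?_
        rw [abs_mul, abs_of_nonneg (hnn j k)]
    _ = (1 - ε) * ∑ j, |transitionDeviation Q π t i j| := by
        rw [Finset.sum_comm, Finset.mul_sum]
        refine Finset.sum_congr rfl fun j _ => ?_
        rw [← Finset.mul_sum, Finset.sum_sub_distrib, ← Finset.mul_sum, hπ.sum_eq_one,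
          (hP 1 zero_le_one j).2]
        ring

lemma integrableOn_deviation (hirr : IsIrreducibleGenerator Q) (i j : S) :
    IntegrableOn (fun t => transitionDeviation Q π t i j) (Set.Ioi 0) := by
  obtain ⟨r, hr0, hr1, hr⟩ := hP.exists_contraction hπ hirr
  have hpow : ∀ (n : ℕ) (t : ℝ), 0 ≤ t → ∑ j, |transitionDeviation Q π (t + n) i j| ≤ 2 * r ^ n := by
    intro n
    induction n with
    | zero => intro t ht; simpa using hP.sum_abs_deviation_le_two hπ ht i
    | succ n ih =>
      intro t ht
      have h1 := hr (t + n) (by positivity) i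
      rw [Nat.cast_succ, ← add_assoc]
      calc _ ≤ _ := h1
        _ ≤ r * (2 * r ^ n) := mul_le_mul_of_nonneg_left (ih t ht) hr0.le
        _ = _ := by ring
  -- The factor `1 / r` pays for replacing `⌊t⌋₊` by `t - 1`.
  have hint : IntegrableOn (fun t : ℝ => 2 / r * Real.exp (Real.log r * t)) (Set.Ioi 0) :=
    (integrableOn_exp_mul_Ioi (Real.log_neg hr0 hr1) 0).const_mul _
  refine hint.mono' (continuous_transitionDeviation_apply Q π i j).aestronglyMeasurable ?_
  refine (ae_restrict_iff' measurableSet_Ioi).2 (Eventually.of_forall fun t ht => ?_)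
  have ht0 : 0 ≤ t := le_of_lt ht
  have h1 := hpow ⌊t⌋₊ (t - ⌊t⌋₊) (sub_nonneg.2 (Nat.floor_le ht0))
  rw [sub_add_cancel] at h1
  calc ‖transitionDeviation Q π t i j‖ ≤ ∑ j, |transitionDeviation Q π t i j| :=
        Finset.single_le_sum (f := fun j => |transitionDeviation Q π t i j|)
          (fun _ _ => abs_nonneg _) (Finset.mem_univ j)
    _ ≤ 2 * r ^ (⌊t⌋₊ : ℝ) := by rw [Real.rpow_natCast]; exact h1
    _ ≤ 2 * r ^ (t - 1) := by
        have := Real.rpow_le_rpow_of_exponent_ge hr0 hr1.le (Nat.sub_one_lt_floor t).le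
        linarith
    _ = 2 / r * Real.exp (Real.log r * t) := by
        rw [Real.rpow_sub hr0, Real.rpow_one, Real.rpow_def_of_pos hr0]
        ring

omit hP hπ in
lemma deviationMatrix_apply (i j : S) :
    deviationMatrix Q π i j = ∫ t in Set.Ioi (0 : ℝ), transitionDeviation Q π t i j := rfl

lemma sum_deviationMatrix (hirr : IsIrreducibleGenerator Q) (i : S) :
    ∑ j, deviationMatrix Q π i j = 0 := by
  simp only [deviationMatrix_apply]
  rw [← integral_finsetSum _ fun j _ => hP.integrableOn_deviation hπ hirr i j]
  exact setIntegral_eq_zero_of_forall_eq_zero fun t ht =>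
    hP.sum_deviation_apply hπ (le_of_lt ht) i

lemma tendsto_integral_deviation (hirr : IsIrreducibleGenerator Q) (i j : S) :
    Tendsto (fun t => ∫ u in (0 : ℝ)..t, transitionDeviation Q π u i j) atTop
      (𝓝 (deviationMatrix Q π i j)) :=
  intervalIntegral_tendsto_integral_Ioi 0 (hP.integrableOn_deviation hπ hirr i j) tendsto_id

/-- An integrated Poisson equation: multiplying by `e ^ (Qδ)` shifts the integrand by `δ`, so only
the initial segment survives. -/
lemma deviationMatrix_sub (hirr : IsIrreducibleGenerator Q) {δ : ℝ} (hδ : 0 ≤ δ) (i j : S) :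
    deviationMatrix Q π i j - ∑ k, transitionMatrix Q δ i k * deviationMatrix Q π k j =
      ∫ u in (0 : ℝ)..δ, transitionDeviation Q π u i j := by
  have hint := hP.integrableOn_deviation hπ hirr
  have h1 : ∑ k, transitionMatrix Q δ i k * deviationMatrix Q π k j =
      ∫ t in Set.Ioi δ, transitionDeviation Q π t i j := by
    simp only [deviationMatrix_apply, ← integral_const_mul]
    rw [← integral_finsetSum _ fun k _ => (hint k j).const_mul _]
    simp only [hP.sum_mul_deviation hδ, add_comm δ]
    have := (measurePreserving_add_right volume δ).setIntegral_preimage_emb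
      (measurableEmbedding_addRight δ) (fun t => transitionDeviation Q π t i j) (Set.Ioi δ)
    rwa [Set.preimage_add_const_Ioi, sub_self] at this
  rw [h1, deviationMatrix_apply]
  exact intervalIntegral.integral_Ioi_sub_Ioi (hint i j) hδ

end IsStochasticSemigroup

end MatrixSemigroup

/-! ### Joint measurability of right-continuous paths. -/

lemma tendsto_floor_add_one_div (t : ℝ≥0) :
    Tendsto (fun n : ℕ => ((⌊((n : ℝ≥0) + 1) * t⌋₊ : ℝ≥0) + 1) / (n + 1)) atTop (𝓝[≥] t) := by
  have hle : ∀ n : ℕ, t ≤ ((⌊((n : ℝ≥0) + 1) * t⌋₊ : ℝ≥0) + 1) / (n + 1) := fun n => by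
    rw [le_div_iff₀ (by positivity), mul_comm]
    exact (Nat.lt_floor_add_one _).le
  have hub : ∀ n : ℕ, ((⌊((n : ℝ≥0) + 1) * t⌋₊ : ℝ≥0) + 1) / (n + 1) ≤ t + 1 / (n + 1) := fun n => by
    rw [add_div]
    gcongr
    rw [div_le_iff₀ (by positivity), mul_comm t]
    exact Nat.floor_le zero_le
  refine tendsto_nhdsWithin_iff.2 ⟨?_, Eventually.of_forall hle⟩
  refine tendsto_of_tendsto_of_tendsto_of_le_of_le tendsto_const_nhds ?_ hle hub
  simpa using tendsto_const_nhds.add (tendsto_one_div_add_atTop_nhds_zero_nat (𝕜 := ℝ≥0))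

section Paths

variable {S Ω : Type*} [MeasurableSpace Ω] {X : ℝ≥0 → Ω → S}

lemma measurable_path_indicator_countable [DecidableEq S]
    (hmeas : ∀ t j, MeasurableSet {ω | X t ω = j}) (a : ℕ → ℝ≥0) (j : S) :
    Measurable fun p : ℕ × Ω => if X (a p.1) p.2 = j then (1 : ℝ) else 0 :=
  measurable_from_prod_countable_right fun k =>
    Measurable.ite (hmeas (a k) j) measurable_const measurable_const

/-- Times are rounded up to the grid of mesh `1 / (n + 1)`: only countably many times are then
involved, and right-continuity makes the rounded value eventually exact. -/
lemma measurable_path_indicator [DecidableEq S]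
    (hmeas : ∀ t j, MeasurableSet {ω | X t ω = j})
    (hright : ∀ ω t, ∀ᶠ u in 𝓝[≥] t, X u ω = X t ω) (j : S) :
    Measurable fun p : ℝ≥0 × Ω => if X p.1 p.2 = j then (1 : ℝ) else 0 := by
  have hfloor : ∀ c : ℝ≥0, Measurable fun p : ℝ≥0 × Ω => (⌊c * p.1⌋₊, p.2) := fun c =>
    (Nat.measurable_floor.comp ((measurable_const_mul c).comp measurable_fst)).prodMk
      measurable_snd
  refine measurable_of_tendsto_metrizable
    (fun n : ℕ => (measurable_path_indicator_countable hmeas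
      (fun k => ((k : ℝ≥0) + 1) / (n + 1)) j).comp (hfloor (n + 1)))
    (tendsto_pi_nhds.2 fun p => ?_)
  refine tendsto_const_nhds.congr' ?_
  filter_upwards [(tendsto_floor_add_one_div p.1).eventually (hright p.2 p.1)] with n hn
  simp only [Function.comp_apply, hn]

lemma measurable_path_indicator_real [DecidableEq S]
    (hmeas : ∀ t j, MeasurableSet {ω | X t ω = j})
    (hright : ∀ ω t, ∀ᶠ u in 𝓝[≥] t, X u ω = X t ω) (j : S) :
    Measurable fun p : ℝ × Ω => if X p.1.toNNReal p.2 = j then (1 : ℝ) else 0 :=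
  (measurable_path_indicator hmeas hright j).comp
    ((measurable_real_toNNReal.comp measurable_fst).prodMk measurable_snd)

end Paths

/-! ### One-time laws and expected occupation times. -/

lemma measureReal_eq_sum_inter_fiber {Ω T : Type*} [MeasurableSpace Ω] [Fintype T]
    (μ : Measure Ω) [IsFiniteMeasure μ] (Y : Ω → T) (hY : ∀ s, MeasurableSet {ω | Y ω = s})
    (B : Set Ω) : μ.real B = ∑ s, μ.real ({ω | Y ω = s} ∩ B) := by
  have := sum_measureReal_preimage_singleton (μ := μ.restrict B) Finset.univ (f := Y)
    fun s _ => hY s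
  rw [Finset.coe_univ, Set.preimage_univ, measureReal_restrict_apply MeasurableSet.univ,
    Set.univ_inter] at this
  rw [← this]
  exact Finset.sum_congr rfl fun s _ => measureReal_restrict_apply (hY s)

namespace IsMarkovChain

variable {S Ω : Type*} [Fintype S] [DecidableEq S] [MeasurableSpace Ω]
  {Q : Matrix S S ℝ} {X : ℝ≥0 → Ω → S} {P : S → Measure Ω} (hX : IsMarkovChain Q X P)
include hX

lemma ae_initial (i : S) : ∀ᵐ ω ∂(P i), X 0 ω = i := by
  have := hX.isProbabilityMeasure i
  exact (prob_compl_eq_zero_iff (hX.measurableSet_eq 0 i)).2 (hX.initial i)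

lemma measureReal_eq (i : S) (t : ℝ≥0) (k : S) :
    (P i).real {ω | X t ω = k} = transitionMatrix Q t i k := by
  -- The history consists of time `0` alone, where the state is almost surely `i`.
  have h := hX.markov i 0 (fun _ => 0) (fun _ => i) t k monotone_const
  have h1 : (P i).real {ω | ∀ _ : Fin (0 + 1), X 0 ω = i} = 1 := by
    simp [measureReal_def, hX.initial]
  rw [h1, one_mul, zero_add] at h
  rw [← h]
  refine measureReal_congr (eventuallyEq_set.2 ?_)
  filter_upwards [hX.ae_initial i] with ω hω
  simp [hω]

/-- The entries of row `i` are the probabilities of the states at time `t` under `P i`. -/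
lemma isStochasticSemigroup : IsStochasticSemigroup Q := by
  intro t ht i
  lift t to ℝ≥0 using ht
  have := hX.isProbabilityMeasure i
  refine ⟨fun j => ?_, ?_⟩
  · rw [← hX.measureReal_eq]
    exact measureReal_nonneg
  · have h := measureReal_eq_sum_inter_fiber (P i) (X t) (hX.measurableSet_eq t) Set.univ
    simp only [Set.inter_univ, hX.measureReal_eq, probReal_univ] at h
    exact h.symm

lemma integrable_path_indicator (i j : S) (t : ℝ) :
    Integrable (fun p : ℝ × Ω => if X p.1.toNNReal p.2 = j then (1 : ℝ) else 0)
      ((volume.restrict (Set.uIoc 0 t)).prod (P i)) := by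
  have := hX.isProbabilityMeasure i
  have : IsFiniteMeasure (volume.restrict (Set.uIoc (0 : ℝ) t)) := ⟨by simp [Set.uIoc]⟩
  refine Integrable.of_bound (C := 1) (measurable_path_indicator_real hX.measurableSet_eq
    hX.right_continuous j).aestronglyMeasurable (Eventually.of_forall fun p => ?_)
  split_ifs <;> simp

lemma integrable_occupationTime (i j : S) (t : ℝ) : Integrable (occupationTime X j t) (P i) := by
  have := hX.isProbabilityMeasure i
  have h := (hX.integrable_path_indicator i j t).integral_prod_right
  unfold occupationTime
  simp only [intervalIntegral.intervalIntegral_eq_integral_uIoc]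
  exact h.smul (if (0 : ℝ) ≤ t then (1 : ℝ) else -1)

lemma integral_occupationTime (i j : S) {t : ℝ} (ht : 0 ≤ t) :
    ∫ ω, occupationTime X j t ω ∂(P i) = ∫ u in (0 : ℝ)..t, transitionMatrix Q u i j := by
  have := hX.isProbabilityMeasure i
  have h := integral_integral_swap
    (f := fun (u : ℝ) ω => if X u.toNNReal ω = j then (1 : ℝ) else 0) (hX.integrable_path_indicator i j t)
  rw [Set.uIoc_of_le ht] at h
  simp only [occupationTime, intervalIntegral.integral_of_le ht]
  rw [← h]
  refine setIntegral_congr_fun measurableSet_Ioc fun u hu => ?_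
  have h1 := integral_indicator_one (μ := P i) (hX.measurableSet_eq u.toNNReal j)
  rw [hX.measureReal_eq, Real.coe_toNNReal u hu.1.le] at h1
  refine Eq.trans (integral_congr_ae (Eventually.of_forall fun ω => ?_)) h1
  simp [Set.indicator_apply]

end IsMarkovChain

/-! ### Hitting times along a grid. -/

section SkeletonHitTime

variable {S Ω : Type*} (X : ℝ≥0 → Ω → S) (j : S) (δ : ℝ≥0)

/-- The first time of the grid `δℕ` at which the path is in `j`. -/
noncomputable def skeletonHitTime (ω : Ω) : ℝ≥0∞ :=
  ⨅ (k : ℕ) (_ : X (k * δ) ω = j), ((k * δ : ℝ≥0) : ℝ≥0∞)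

/-- The event that the path avoids `j` at the first `n + 1` times of the grid `δℕ`. -/
def skeletonAvoids (n : ℕ) : Set Ω := {ω | ∀ k ≤ n, X (k * δ) ω ≠ j}

variable {X j}

/-- If `k` is the first grid index in `j`, avoidance up to `n` inclusive holds exactly for the `k`
values `n < k`. If there is none, both sides are infinite. -/
lemma skeletonHitTime_eq_tsum {δ : ℝ≥0} (hδ : 0 < δ) (ω : Ω) :
    skeletonHitTime X j δ ω =
      ∑' n, (skeletonAvoids X j δ n).indicator (fun _ => (δ : ℝ≥0∞)) ω := by
  classical
  by_cases h : ∃ k : ℕ, X (k * δ) ω = j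
  · have hmem : ∀ n, ω ∈ skeletonAvoids X j δ n ↔ n ∈ Finset.range (Nat.find h) := fun n => by
      simp [skeletonAvoids, Nat.lt_find_iff]
    rw [tsum_eq_sum (s := Finset.range (Nat.find h)) fun n hn =>
      Set.indicator_of_notMem (mt (hmem n).1 hn) _]
    rw [Finset.sum_congr rfl fun n hn => Set.indicator_of_mem ((hmem n).2 hn) _]
    rw [Finset.sum_const, Finset.card_range, nsmul_eq_mul]
    refine le_antisymm ?_ ?_
    · refine (iInf₂_le (Nat.find h) (Nat.find_spec h)).trans_eq (by push_cast; rfl)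
    · refine le_iInf₂ fun k hk => ?_
      push_cast
      gcongr
      exact Nat.find_min' h hk
  · have h' : ∀ k : ℕ, X (k * δ) ω ≠ j := not_exists.1 h
    have hmem : ∀ n, ω ∈ skeletonAvoids X j δ n := fun n k _ => h' k
    simp only [skeletonHitTime, h', Set.indicator_of_mem (hmem _), iInf_false, iInf_const]
    rw [ENNReal.tsum_const_eq_top_of_ne_zero (by simpa using hδ.ne')]

lemma hitTime_le_skeletonHitTime (ω : Ω) : hitTime X j ω ≤ skeletonHitTime X j δ ω :=
  le_iInf₂ fun k hk => iInf₂_le (k * δ : ℝ≥0) hk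

/-- After a visit at `t` the path stays in `j` on some `[t, b)`. A mesh below `b - t` has a grid
point there, and a mesh below `ε` overshoots `t` by less than `ε`. -/
lemma hitTime_eq_iInf_skeletonHitTime (hright : ∀ ω t, ∀ᶠ u in 𝓝[≥] t, X u ω = X t ω)
    {δ : ℕ → ℝ≥0} (hpos : ∀ n, 0 < δ n) (hδ : Tendsto δ atTop (𝓝 0)) (ω : Ω) :
    hitTime X j ω = ⨅ n, skeletonHitTime X j (δ n) ω := by
  refine le_antisymm (le_iInf fun n => hitTime_le_skeletonHitTime (δ n) ω) ?_
  refine le_iInf₂ fun t ht => ENNReal.le_of_forall_pos_le_add fun ε hε _ => ?_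
  obtain ⟨b, hb, hIco⟩ := (mem_nhdsGE_iff_exists_Ico_subset' (lt_add_of_pos_right t hε)).1
    (hright ω t)
  have hb' : 0 < min ε (b - t) := lt_min hε (tsub_pos_of_lt hb)
  obtain ⟨n, hn⟩ := (hδ.eventually (gt_mem_nhds hb')).exists
  obtain ⟨hnε, hnb⟩ := lt_min_iff.1 hn
  have h1 : t ≤ ⌈t / δ n⌉₊ * δ n := (div_le_iff₀ (hpos n)).1 (Nat.le_ceil _)
  have h2 : ⌈t / δ n⌉₊ * δ n < t + δ n := by
    have := mul_lt_mul_of_pos_right (Nat.ceil_lt_add_one (zero_le (a := t / δ n))) (hpos n)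
    rwa [add_mul, one_mul, div_mul_cancel₀ _ (hpos n).ne'] at this
  have h3 : X (⌈t / δ n⌉₊ * δ n) ω = j := by
    rw [← ht]
    exact hIco ⟨h1, h2.trans (by rw [add_comm]; exact lt_tsub_iff_right.1 hnb)⟩
  calc ⨅ n, skeletonHitTime X j (δ n) ω ≤ skeletonHitTime X j (δ n) ω := iInf_le _ n
    _ ≤ ((⌈t / δ n⌉₊ * δ n : ℝ≥0) : ℝ≥0∞) := iInf₂_le (⌈t / δ n⌉₊ : ℕ) h3
    _ ≤ ((t + ε : ℝ≥0) : ℝ≥0∞) := by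
      exact_mod_cast h2.le.trans (by gcongr)
    _ = t + ε := by push_cast; rfl

/-- Halving the mesh refines the grid, which provides the monotonicity needed to pass to the limit
under the expectation. -/
lemma skeletonHitTime_half_le (ω : Ω) : skeletonHitTime X j (δ / 2) ω ≤ skeletonHitTime X j δ ω := by
  refine le_iInf₂ fun k hk => ?_
  have h : ((2 * k : ℕ) : ℝ≥0) * (δ / 2) = k * δ := by
    push_cast
    field_simp
  refine (iInf₂_le (2 * k) (by rwa [h])).trans_eq ?_
  rw [h]

lemma measurableSet_skeletonAvoids [MeasurableSpace Ω]
    (hmeas : ∀ t j, MeasurableSet {ω | X t ω = j}) (n : ℕ) :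
    MeasurableSet (skeletonAvoids X j δ n) := by
  simp only [skeletonAvoids, Set.ofPred_forall]
  exact MeasurableSet.iInter fun k => MeasurableSet.iInter fun _ => (hmeas _ j).compl

variable {δ}

lemma measurable_skeletonHitTime [MeasurableSpace Ω] (hδ : 0 < δ)
    (hmeas : ∀ t j, MeasurableSet {ω | X t ω = j}) :
    Measurable (skeletonHitTime X j δ) := by
  rw [funext (skeletonHitTime_eq_tsum hδ)]
  exact Measurable.tsum fun n =>
    measurable_const.indicator (measurableSet_skeletonAvoids δ hmeas n)

lemma lintegral_skeletonHitTime [MeasurableSpace Ω] (hδ : 0 < δ)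
    (hmeas : ∀ t j, MeasurableSet {ω | X t ω = j}) (μ : Measure Ω) :
    ∫⁻ ω, skeletonHitTime X j δ ω ∂μ = ∑' n, δ * μ (skeletonAvoids X j δ n) := by
  simp only [skeletonHitTime_eq_tsum hδ]
  rw [lintegral_tsum fun n =>
    (measurable_const.indicator (measurableSet_skeletonAvoids δ hmeas n)).aemeasurable]
  exact tsum_congr fun n =>
    lintegral_indicator_const (measurableSet_skeletonAvoids δ hmeas n) _

end SkeletonHitTime

/-! ### The chain on the grid, killed at `j`: a drift criterion. -/

namespace IsMarkovChain

variable {S Ω : Type*} [Fintype S] [DecidableEq S] [MeasurableSpace Ω]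
  {Q : Matrix S S ℝ} {X : ℝ≥0 → Ω → S} {P : S → Measure Ω} (hX : IsMarkovChain Q X P)
include hX

/-- The Markov property is available for fully specified histories, so the event is split along the
histories at the first `n + 1` grid times. Each history either decides the event or is incompatible
with it. -/
lemma markov_skeletonAvoids (i j l k : S) (δ : ℝ≥0) (n : ℕ) :
    (P i).real {ω | ω ∈ skeletonAvoids X j δ n ∧ X (n * δ) ω = l ∧ X ((n + 1 : ℕ) * δ) ω = k} =
      (P i).real {ω | ω ∈ skeletonAvoids X j δ n ∧ X (n * δ) ω = l} * transitionMatrix Q δ l k := by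
  have := hX.isProbabilityMeasure i
  let t : Fin (n + 1) → ℝ≥0 := fun m => (m : ℕ) * δ
  have ht : Monotone t := fun a b hab => by
    have : (a : ℕ) ≤ b := hab
    dsimp only [t]
    gcongr
  let Y : Ω → Fin (n + 1) → S := fun ω m => X (t m) ω
  have hYs : ∀ s, {ω | Y ω = s} = {ω | ∀ m, X (t m) ω = s m} := fun s => by
    ext ω
    exact funext_iff
  have hY : ∀ s, MeasurableSet {ω | Y ω = s} := fun s => by
    rw [hYs, Set.ofPred_forall]
    exact MeasurableSet.iInter fun m => hX.measurableSet_eq _ _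
  have hnext : ((n + 1 : ℕ) : ℝ≥0) * δ = t (Fin.last n) + δ := by
    simp only [t, Fin.val_last]
    push_cast
    ring
  have hgood : ∀ ω, (ω ∈ skeletonAvoids X j δ n ∧ X (n * δ) ω = l) ↔
      (∀ m, Y ω m ≠ j) ∧ Y ω (Fin.last n) = l := fun ω => by
    refine and_congr ⟨fun h m => h m (Nat.lt_succ_iff.1 m.2), fun h m hm => ?_⟩ (by simp [Y, t])
    exact h ⟨m, Nat.lt_succ_iff.2 hm⟩
  rw [measureReal_eq_sum_inter_fiber (P i) Y hY,
    measureReal_eq_sum_inter_fiber (P i) Y hY {ω | ω ∈ skeletonAvoids X j δ n ∧ _},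
    Finset.sum_mul]
  refine Finset.sum_congr rfl fun s _ => ?_
  by_cases hs : (∀ m, s m ≠ j) ∧ s (Fin.last n) = l
  · have h1 : {ω | Y ω = s} ∩ {ω | ω ∈ skeletonAvoids X j δ n ∧ X (n * δ) ω = l ∧
        X ((n + 1 : ℕ) * δ) ω = k} =
        {ω | (∀ m, X (t m) ω = s m) ∧ X (t (Fin.last n) + δ) ω = k} := by
      ext ω
      simp only [Set.mem_inter_iff, Set.mem_ofPred_eq, ← and_assoc, hnext]
      rw [and_congr_left_iff, and_assoc, hgood]
      intro _
      rw [← funext_iff (f := fun m => X (t m) ω)]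
      exact ⟨fun h => h.1, fun h => ⟨h, by rw [show Y ω = s from h]; exact hs⟩⟩
    have h2 : {ω | Y ω = s} ∩ {ω | ω ∈ skeletonAvoids X j δ n ∧ X (n * δ) ω = l} =
        {ω | ∀ m, X (t m) ω = s m} := by
      rw [← hYs]
      refine Set.inter_eq_left.2 fun ω hω => (hgood ω).2 ?_
      rw [show Y ω = s from hω]
      exact hs
    rw [h1, h2, hX.markov i n t s δ k ht, hs.2]
  · have h2 : {ω | Y ω = s} ∩ {ω | ω ∈ skeletonAvoids X j δ n ∧ X (n * δ) ω = l} = ∅ := by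
      refine Set.eq_empty_of_forall_notMem fun ω hω => hs ?_
      rw [← show Y ω = s from hω.1]
      exact (hgood ω).1 hω.2
    have h1 : {ω | Y ω = s} ∩ {ω | ω ∈ skeletonAvoids X j δ n ∧ X (n * δ) ω = l ∧
        X ((n + 1 : ℕ) * δ) ω = k} = ∅ :=
      Set.subset_empty_iff.1 (h2 ▸ fun ω hω => ⟨hω.1, hω.2.1, hω.2.2.1⟩)
    rw [h1, h2, measureReal_empty, zero_mul]

omit hX [Fintype S] [DecidableEq S] [MeasurableSpace Ω] in
lemma setOf_skeletonAvoids_self (j : S) (δ : ℝ≥0) (n : ℕ) :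
    {ω | ω ∈ skeletonAvoids X j δ n ∧ X (n * δ) ω = j} = ∅ :=
  Set.eq_empty_of_forall_notMem fun _ hω => hω.1 n le_rfl hω.2

lemma measureReal_skeletonAvoids_succ (i : S) {j k : S} (hk : k ≠ j) (δ : ℝ≥0) (n : ℕ) :
    (P i).real {ω | ω ∈ skeletonAvoids X j δ (n + 1) ∧ X ((n + 1 : ℕ) * δ) ω = k} =
      ∑ l, (P i).real {ω | ω ∈ skeletonAvoids X j δ n ∧ X (n * δ) ω = l} *
        transitionMatrix Q δ l k := by
  have := hX.isProbabilityMeasure i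
  rw [measureReal_eq_sum_inter_fiber (P i) (X (n * δ)) (hX.measurableSet_eq _)]
  refine Finset.sum_congr rfl fun l _ => ?_
  rw [← hX.markov_skeletonAvoids]
  congr 1
  ext ω
  have hsucc : ω ∈ skeletonAvoids X j δ (n + 1) ↔
      ω ∈ skeletonAvoids X j δ n ∧ X ((n + 1 : ℕ) * δ) ω ≠ j := by
    simp only [skeletonAvoids, Set.mem_ofPred_eq, Nat.le_succ_iff, or_imp, forall_and,
      forall_eq, Nat.succ_eq_add_one]
  simp only [Set.mem_inter_iff, Set.mem_ofPred_eq, hsucc]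
  constructor
  · rintro ⟨h1, ⟨h2, -⟩, h3⟩
    exact ⟨h2, h1, h3⟩
  · rintro ⟨h1, h2, h3⟩
    exact ⟨h2, ⟨h1, h3 ▸ hk⟩, h3⟩

lemma measureReal_skeletonAvoids_eq_sum (i j : S) (δ : ℝ≥0) (n : ℕ) :
    (P i).real (skeletonAvoids X j δ n) =
      ∑ l, (P i).real {ω | ω ∈ skeletonAvoids X j δ n ∧ X (n * δ) ω = l} := by
  have := hX.isProbabilityMeasure i
  rw [measureReal_eq_sum_inter_fiber (P i) (X (n * δ)) (hX.measurableSet_eq _)]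
  refine Finset.sum_congr rfl fun l _ => ?_
  rw [Set.inter_comm]
  rfl

/-- The expectation of `f` at the `n`-th grid time, on the event that `j` has been avoided. -/
lemma sum_skeletonAvoids_mul_zero (i : S) {j : S} (δ : ℝ≥0) {f : S → ℝ} (hf : f j = 0) :
    ∑ l, (P i).real {ω | ω ∈ skeletonAvoids X j δ 0 ∧ X ((0 : ℕ) * δ) ω = l} * f l = f i := by
  have := hX.isProbabilityMeasure i
  have h : ∀ l, (P i).real {ω | ω ∈ skeletonAvoids X j δ 0 ∧ X ((0 : ℕ) * δ) ω = l} * f l =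
      if l = i then f l else 0 := fun l => by
    by_cases hlj : l = j
    · simp [hlj, hf]
    · have h1 : {ω | ω ∈ skeletonAvoids X j δ 0 ∧ X ((0 : ℕ) * δ) ω = l} = {ω | X 0 ω = l} := by
        ext ω
        simp only [skeletonAvoids, Set.mem_ofPred_eq, Nat.le_zero, forall_eq, Nat.cast_zero, zero_mul]
        exact ⟨fun h => h.2, fun h => ⟨h ▸ hlj, h⟩⟩
      rw [h1, hX.measureReal_eq, NNReal.coe_zero, transitionMatrix_zero, Matrix.one_apply]
      by_cases hli : l = i
      · simp [hli]
      · simp [hli, Ne.symm hli]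
  simp only [h, Finset.sum_ite_eq', Finset.mem_univ, if_true]

/-- Since `f j = 0`, mass killed on entering `j` does not matter, and the full transition matrix can
replace the killed one. -/
lemma sum_skeletonAvoids_mul_succ (i : S) {j : S} (δ : ℝ≥0) (n : ℕ) {f : S → ℝ} (hf : f j = 0) :
    ∑ k, (P i).real {ω | ω ∈ skeletonAvoids X j δ (n + 1) ∧ X ((n + 1 : ℕ) * δ) ω = k} * f k =
      ∑ l, (P i).real {ω | ω ∈ skeletonAvoids X j δ n ∧ X (n * δ) ω = l} *
        ∑ k, transitionMatrix Q δ l k * f k := by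
  have h : ∀ k, (P i).real {ω | ω ∈ skeletonAvoids X j δ (n + 1) ∧ X ((n + 1 : ℕ) * δ) ω = k} * f k =
      ∑ l, (P i).real {ω | ω ∈ skeletonAvoids X j δ n ∧ X (n * δ) ω = l} *
        (transitionMatrix Q δ l k * f k) := fun k => by
    by_cases hk : k = j
    · simp [hk, hf]
    · rw [hX.measureReal_skeletonAvoids_succ i hk, Finset.sum_mul]
      simp only [mul_assoc]
  simp only [h, Finset.mul_sum]
  exact Finset.sum_comm

/-- If the drift of `f` over a grid step lies between `-b` and `-a < 0` outside of `j`, and `f`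
vanishes in `j`, then the expected number of grid times before hitting `j` lies between `f / b`
and `f / a`. -/
lemma summable_skeletonAvoids_of_drift (i : S) {j : S} (δ : ℝ≥0) {f : S → ℝ} (hf : f j = 0)
    {a b : ℝ} (ha : 0 < a)
    (hfa : ∀ l, l ≠ j → a ≤ f l - ∑ k, transitionMatrix Q δ l k * f k)
    (hfb : ∀ l, l ≠ j → f l - ∑ k, transitionMatrix Q δ l k * f k ≤ b) :
    Summable (fun n => (P i).real (skeletonAvoids X j δ n)) ∧
      a * ∑' n, (P i).real (skeletonAvoids X j δ n) ≤ f i ∧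
      f i ≤ b * ∑' n, (P i).real (skeletonAvoids X j δ n) := by
  have := hX.isProbabilityMeasure i
  let w : ℕ → S → ℝ := fun n l => (P i).real {ω | ω ∈ skeletonAvoids X j δ n ∧ X (n * δ) ω = l}
  let m : ℕ → ℝ := fun n => (P i).real (skeletonAvoids X j δ n)
  let G : ℕ → ℝ := fun n => ∑ l, w n l * f l
  have hw0 : ∀ n l, 0 ≤ w n l := fun n l => measureReal_nonneg
  have hwj : ∀ n, w n j = 0 := fun n => by
    simp only [w, setOf_skeletonAvoids_self, measureReal_empty]
  have hm : ∀ n, m n = ∑ l, w n l := fun n => hX.measureReal_skeletonAvoids_eq_sum i j δ n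
  have hm0 : ∀ n, 0 ≤ m n := fun n => measureReal_nonneg
  have hm1 : ∀ n, m n ≤ 1 := fun n => measureReal_le_one
  have hG0 : G 0 = f i := hX.sum_skeletonAvoids_mul_zero i δ hf
  have hGstep : ∀ n, G n - G (n + 1) =
      ∑ l, w n l * (f l - ∑ k, transitionMatrix Q δ l k * f k) := fun n => by
    simp only [mul_sub, Finset.sum_sub_distrib]
    rw [← hX.sum_skeletonAvoids_mul_succ i δ n hf]
  have hlow : ∀ n, a * m n ≤ G n - G (n + 1) := fun n => by
    rw [hGstep, hm, Finset.mul_sum]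
    refine Finset.sum_le_sum fun l _ => ?_
    by_cases hl : l = j
    · simp [hl, hwj]
    · rw [mul_comm]
      exact mul_le_mul_of_nonneg_left (hfa l hl) (hw0 n l)
  have hupp : ∀ n, G n - G (n + 1) ≤ b * m n := fun n => by
    rw [hGstep, hm, Finset.mul_sum]
    refine Finset.sum_le_sum fun l _ => ?_
    by_cases hl : l = j
    · simp [hl, hwj]
    · rw [mul_comm b]
      exact mul_le_mul_of_nonneg_left (hfb l hl) (hw0 n l)
  have hGabs : ∀ n, |G n| ≤ m n * ∑ l, |f l| := fun n => by
    rw [hm, Finset.sum_mul]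
    refine (Finset.abs_sum_le_sum_abs _ _).trans (Finset.sum_le_sum fun l _ => ?_)
    rw [abs_mul, abs_of_nonneg (hw0 n l)]
    exact mul_le_mul_of_nonneg_left
      (Finset.single_le_sum (f := fun l => |f l|) (fun _ _ => abs_nonneg _) (Finset.mem_univ l))
      (hw0 n l)
  have hF : 0 ≤ ∑ l, |f l| := Finset.sum_nonneg fun _ _ => abs_nonneg _
  have hGbd : ∀ n, |G n| ≤ ∑ l, |f l| := fun n =>
    (hGabs n).trans (mul_le_of_le_one_left hF (hm1 n))
  -- The lower drift bound telescopes against the bounded sequence `G`.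
  have hsum : Summable m := by
    refine summable_of_sum_range_le (c := (f i + ∑ l, |f l|) / a) hm0 fun N => ?_
    rw [le_div_iff₀ ha, mul_comm, Finset.mul_sum]
    refine (Finset.sum_le_sum fun n _ => hlow n).trans ?_
    rw [Finset.sum_range_sub', hG0]
    linarith [neg_le_of_abs_le (hGbd N)]
  -- Summability forces the surviving mass to zero, so no boundary term remains and the drifts add
  -- up to exactly `f i`.
  have hGlim : Tendsto G atTop (𝓝 0) := by
    refine squeeze_zero_norm hGabs ?_
    simpa using hsum.tendsto_atTop_zero.mul_const (∑ l, |f l|)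
  have htel : Tendsto (fun N => ∑ n ∈ Finset.range N, (G n - G (n + 1))) atTop (𝓝 (f i)) := by
    simp only [Finset.sum_range_sub', hG0]
    simpa using hGlim.const_sub (f i)
  have hlim : ∀ c, Tendsto (fun N => ∑ n ∈ Finset.range N, c * m n) atTop (𝓝 (c * ∑' n, m n)) :=
    fun c => (hsum.hasSum.mul_left c).tendsto_sum_nat
  exact ⟨hsum,
    le_of_tendsto_of_tendsto' (hlim a) htel fun N => Finset.sum_le_sum fun n _ => hlow n,
    le_of_tendsto_of_tendsto' htel (hlim b) fun N => Finset.sum_le_sum fun n _ => hupp n⟩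

end IsMarkovChain

/-! ### Drift of a column of the deviation matrix. -/

namespace IsStochasticSemigroup

variable {S : Type*} [Fintype S] [DecidableEq S] {Q : Matrix S S ℝ} {π : S → ℝ}
  (hP : IsStochasticSemigroup Q)
include hP

lemma deviationMatrix_drift (hπ : IsStationaryDistribution Q π) (hirr : IsIrreducibleGenerator Q)
    {δ : ℝ} (hδ : 0 ≤ δ) (l j : S) :
    (deviationMatrix Q π j j - deviationMatrix Q π l j) -
        ∑ k, transitionMatrix Q δ l k * (deviationMatrix Q π j j - deviationMatrix Q π k j) =
      π j * δ - ∫ u in (0 : ℝ)..δ, transitionMatrix Q u l j := by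
  have h1 := hP.deviationMatrix_sub hπ hirr hδ l j
  simp only [transitionDeviation_apply] at h1
  rw [intervalIntegral.integral_sub
    ((continuous_transitionMatrix_apply Q l j).intervalIntegrable _ _) intervalIntegrable_const,
    intervalIntegral.integral_const, smul_eq_mul, sub_zero] at h1
  simp only [mul_sub, Finset.sum_sub_distrib, ← Finset.sum_mul, (hP δ hδ l).2, one_mul]
  linarith

omit hP in
-- The integrand is continuous and vanishes at `u = 0` when `l ≠ j`, so the error in the drift is
-- `o(δ)`.
lemma eventually_integral_le (j : S) {η : ℝ} (hη : 0 < η) :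
    ∀ᶠ δ in 𝓝[>] (0 : ℝ), ∀ l, l ≠ j → ∫ u in (0 : ℝ)..δ, transitionMatrix Q u l j ≤ η * δ := by
  refine eventually_all.2 fun l => ?_
  by_cases hl : l = j
  · simp [hl]
  have h0 : ∀ᶠ u in 𝓝 (0 : ℝ), transitionMatrix Q u l j ≤ η := by
    have := (continuous_transitionMatrix_apply Q l j).tendsto 0
    rw [transitionMatrix_zero, Matrix.one_apply_ne hl] at this
    exact this.eventually_le_const hη
  obtain ⟨ε, hε, h⟩ := Metric.eventually_nhds_iff.1 h0
  filter_upwards [Ioo_mem_nhdsGT hε] with δ hδ _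
  calc ∫ u in (0 : ℝ)..δ, transitionMatrix Q u l j ≤ ∫ _ in (0 : ℝ)..δ, η := by
        refine intervalIntegral.integral_mono_on hδ.1.le
          ((continuous_transitionMatrix_apply Q l j).intervalIntegrable _ _)
          intervalIntegrable_const fun u hu => h ?_
        rw [Real.dist_0_eq_abs, abs_of_nonneg hu.1]
        exact hu.2.trans_lt hδ.2
    _ = η * δ := by simp [mul_comm]

end IsStochasticSemigroup

/-! ### Vanishing mesh: expected hitting times and conclusions. -/

namespace IsMarkovChain

variable {S Ω : Type*} [Fintype S] [DecidableEq S] [MeasurableSpace Ω]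
  {Q : Matrix S S ℝ} {π : S → ℝ} {X : ℝ≥0 → Ω → S} {P : S → Measure Ω}
  (hX : IsMarkovChain Q X P)
include hX

lemma measurable_hitTime (j : S) : Measurable (hitTime X j) := by
  have hpos : ∀ n : ℕ, (0 : ℝ≥0) < 1 / (n + 1) := fun n => by positivity
  rw [funext (hitTime_eq_iInf_skeletonHitTime (j := j) hX.right_continuous hpos
    tendsto_one_div_add_atTop_nhds_zero_nat)]
  exact Measurable.iInf fun n => measurable_skeletonHitTime (hpos n) hX.measurableSet_eq

/-- The drift criterion is applied with `a = (π j - η) * δ` and `b = π j * δ`; the factor `δ` turns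
the expected number of grid steps into time. -/
lemma eventually_lintegral_skeletonHitTime (hirr : IsIrreducibleGenerator Q)
    (hπ : IsStationaryDistribution Q π) (i j : S) {η : ℝ} (hη : 0 < η) (hηπ : η < π j) :
    ∀ᶠ δ in 𝓝[>] (0 : ℝ≥0), (∫⁻ ω, skeletonHitTime X j δ ω ∂(P i)) ≠ ∞ ∧
      (π j - η) * (∫⁻ ω, skeletonHitTime X j δ ω ∂(P i)).toReal ≤
        deviationMatrix Q π j j - deviationMatrix Q π i j ∧
      deviationMatrix Q π j j - deviationMatrix Q π i j ≤
        π j * (∫⁻ ω, skeletonHitTime X j δ ω ∂(P i)).toReal := by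
  have hP := hX.isStochasticSemigroup
  have := hX.isProbabilityMeasure i
  have hcoe : Tendsto ((↑) : ℝ≥0 → ℝ) (𝓝[>] 0) (𝓝[>] 0) :=
    tendsto_nhdsWithin_iff.2 ⟨(NNReal.continuous_coe.tendsto 0).mono_left nhdsWithin_le_nhds,
      eventually_nhdsWithin_of_forall fun δ hδ => NNReal.coe_pos.2 hδ⟩
  filter_upwards [hcoe.eventually (IsStochasticSemigroup.eventually_integral_le (Q := Q) j hη),
    self_mem_nhdsWithin] with δ hδ hδ0
  have hδ0 : 0 < δ := hδ0
  have hδr : (0 : ℝ) < δ := NNReal.coe_pos.2 hδ0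
  obtain ⟨hs, h1, h2⟩ := hX.summable_skeletonAvoids_of_drift i δ
    (f := fun l => deviationMatrix Q π j j - deviationMatrix Q π l j) (sub_self _)
    (a := (π j - η) * δ) (b := π j * δ) (mul_pos (sub_pos.2 hηπ) hδr)
    (fun l hl => by
      rw [hP.deviationMatrix_drift hπ hirr hδr.le]
      linarith [hδ l hl])
    (fun l _ => by
      rw [hP.deviationMatrix_drift hπ hirr hδr.le]
      linarith [intervalIntegral.integral_nonneg (μ := volume) hδr.le
        fun u hu => (hP u hu.1 l).1 j])
  have hE : ∫⁻ ω, skeletonHitTime X j δ ω ∂(P i) =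
      ENNReal.ofReal (δ * ∑' n, (P i).real (skeletonAvoids X j δ n)) := by
    rw [lintegral_skeletonHitTime hδ0 hX.measurableSet_eq, ENNReal.tsum_mul_left,
      ENNReal.ofReal_mul hδr.le, ENNReal.ofReal_coe_nnreal,
      ENNReal.ofReal_tsum_of_nonneg (fun _ => measureReal_nonneg) hs]
    simp
  have hE' : 0 ≤ (δ : ℝ) * ∑' n, (P i).real (skeletonAvoids X j δ n) :=
    mul_nonneg hδr.le (tsum_nonneg fun _ => measureReal_nonneg)
  rw [hE, ENNReal.toReal_ofReal hE', ← mul_assoc, ← mul_assoc]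
  exact ⟨ENNReal.ofReal_ne_top, h1, h2⟩

/-- The expected hitting times in terms of the deviation matrix. -/
theorem lintegral_hitTime (hirr : IsIrreducibleGenerator Q)
    (hπ : IsStationaryDistribution Q π) (i j : S) :
    (∫⁻ ω, hitTime X j ω ∂(P i)) ≠ ∞ ∧
      π j * (∫⁻ ω, hitTime X j ω ∂(P i)).toReal =
        deviationMatrix Q π j j - deviationMatrix Q π i j := by
  have hπj := hX.isStochasticSemigroup.stationary_pos hirr hπ j
  let δ : ℕ → ℝ≥0 := fun n => (1 / 2) ^ n
  have hpos : ∀ n, 0 < δ n := fun n => by positivity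
  have hδ : Tendsto δ atTop (𝓝 0) :=
    NNReal.tendsto_pow_atTop_nhds_zero_of_lt_one (by rw [← NNReal.coe_lt_coe]; norm_num)
  have hδ' : Tendsto δ atTop (𝓝[>] 0) :=
    tendsto_nhdsWithin_iff.2 ⟨hδ, Eventually.of_forall hpos⟩
  have hev := fun η (hη : 0 < η) (hηπ : η < π j) =>
    hδ'.eventually (hX.eventually_lintegral_skeletonHitTime hirr hπ i j hη hηπ)
  have hanti : ∀ ω, Antitone fun n => skeletonHitTime X j (δ n) ω := fun ω =>
    antitone_nat_of_succ_le fun n => by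
      have : δ (n + 1) = δ n / 2 := by simp only [δ, pow_succ]; ring
      rw [this]
      exact skeletonHitTime_half_le (δ n) ω
  have hlim : ∀ ω, Tendsto (fun n => skeletonHitTime X j (δ n) ω) atTop (𝓝 (hitTime X j ω)) :=
    fun ω => by
      rw [hitTime_eq_iInf_skeletonHitTime hX.right_continuous hpos hδ]
      exact tendsto_atTop_iInf (hanti ω)
  -- One mesh with finite expectation starts the decreasing convergence and bounds `E_i[θ_j]`.
  obtain ⟨N, hN⟩ := (hev (π j / 2) (by linarith) (by linarith)).exists
  have hE : Tendsto (fun n => ∫⁻ ω, skeletonHitTime X j (δ n) ω ∂(P i)) atTop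
      (𝓝 (∫⁻ ω, hitTime X j ω ∂(P i))) := by
    refine (tendsto_add_atTop_iff_nat N).1 ?_
    refine lintegral_tendsto_of_tendsto_of_antitone
      (fun n => (measurable_skeletonHitTime (hpos _) hX.measurableSet_eq).aemeasurable)
      (ae_of_all _ fun ω a b hab => hanti ω (by gcongr)) ?_
      (ae_of_all _ fun ω => (tendsto_add_atTop_iff_nat N).2 (hlim ω))
    rw [zero_add]
    exact hN.1
  have hfin : (∫⁻ ω, hitTime X j ω ∂(P i)) ≠ ∞ :=
    ne_top_of_le_ne_top hN.1 (lintegral_mono fun ω => hitTime_le_skeletonHitTime (δ N) ω)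
  have hEr := (ENNReal.tendsto_toReal hfin).comp hE
  refine ⟨hfin, le_antisymm ?_ ?_⟩
  -- The mesh tends to zero at fixed `η`; only then does `η` tend to zero. The reverse bound is free
  -- of `η`, so any admissible value serves there.
  · have h1 : ∀ᶠ η in 𝓝[>] (0 : ℝ), (π j - η) * (∫⁻ ω, hitTime X j ω ∂(P i)).toReal ≤
        deviationMatrix Q π j j - deviationMatrix Q π i j := by
      filter_upwards [Ioo_mem_nhdsGT hπj] with η hη
      exact le_of_tendsto (hEr.const_mul _) ((hev η hη.1 hη.2).mono fun n hn => hn.2.1)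
    have h2 : Tendsto (fun η => (π j - η) * (∫⁻ ω, hitTime X j ω ∂(P i)).toReal) (𝓝[>] (0 : ℝ))
        (𝓝 (π j * (∫⁻ ω, hitTime X j ω ∂(P i)).toReal)) := by
      have : Continuous fun η => (π j - η) * (∫⁻ ω, hitTime X j ω ∂(P i)).toReal := by fun_prop
      simpa using (this.tendsto 0).mono_left nhdsWithin_le_nhds
    exact le_of_tendsto h2 h1
  · exact ge_of_tendsto (hEr.const_mul _)
      ((hev (π j / 2) (by linarith) (by linarith)).mono fun n hn => hn.2.2)

lemma sum_stationary_mul_hitTime (hirr : IsIrreducibleGenerator Q)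
    (hπ : IsStationaryDistribution Q π) (i : S) :
    ∑ j, π j * (∫⁻ ω, hitTime X j ω ∂(P i)).toReal = (deviationMatrix Q π).trace := by
  simp only [(hX.lintegral_hitTime hirr hπ i _).2, Finset.sum_sub_distrib,
    hX.isStochasticSemigroup.sum_deviationMatrix hπ hirr, sub_zero]
  rfl

/-- The linear term does not depend on `i`, so it cancels between starting states; over all `j` it
sums to `t`. -/
lemma integral_occupationTime_eq_add (i j : S) {t : ℝ} (ht : 0 ≤ t) :
    ∫ ω, occupationTime X j t ω ∂(P i) =
      (∫ u in (0 : ℝ)..t, transitionDeviation Q π u i j) + t * π j := by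
  simp only [transitionDeviation_apply]
  rw [hX.integral_occupationTime i j ht, intervalIntegral.integral_sub
    ((continuous_transitionMatrix_apply Q i j).intervalIntegrable _ _) intervalIntegrable_const,
    intervalIntegral.integral_const, smul_eq_mul, sub_zero, sub_add_cancel]

end IsMarkovChain

theorem lemma2 {S Ω : Type*} [Fintype S] [DecidableEq S] [MeasurableSpace Ω]
    (Q : Matrix S S ℝ) (hQ : IsGenerator Q) (hirr : IsIrreducibleGenerator Q)
    (π : S → ℝ) (hπ : IsStationaryDistribution Q π)
    (X : ℝ≥0 → Ω → S) (P : S → Measure Ω) (hX : IsMarkovChain Q X P) :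
    -- all the expectations and integrals below are well defined and finite
    (∀ j, Measurable (hitTime X j)) ∧
    (∀ i j, (∫⁻ ω, hitTime X j ω ∂(P i)) ≠ ∞) ∧
    (∀ i j (t : ℝ), 0 ≤ t → Integrable (occupationTime X j t) (P i)) ∧
    (∀ i j, IntegrableOn
      (fun t : ℝ => (transitionMatrix Q t - Matrix.vecMulVec (1 : S → ℝ) π) i j)
      (Set.Ioi 0)) ∧
    -- the limit formula for a pair of states
    (∀ i j, Tendsto
      (fun t : ℝ => (∫ ω, occupationTime X j t ω ∂(P j)) - (∫ ω, occupationTime X j t ω ∂(P i)))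
      atTop (𝓝 (π j * (∫⁻ ω, hitTime X j ω ∂(P i)).toReal))) ∧
    -- the sum over all target states: limit formula, independence of `i`, and trace formula
    (∀ i, Tendsto
      (fun t : ℝ => (∑ j, (∫ ω, occupationTime X j t ω ∂(P j))) - t)
      atTop (𝓝 (∑ j, π j * (∫⁻ ω, hitTime X j ω ∂(P i)).toReal))) ∧
    (∀ i i', (∑ j, π j * (∫⁻ ω, hitTime X j ω ∂(P i)).toReal) =
      ∑ j, π j * (∫⁻ ω, hitTime X j ω ∂(P i')).toReal) ∧
    (∀ i, (∑ j, π j * (∫⁻ ω, hitTime X j ω ∂(P i)).toReal) =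
      (deviationMatrix Q π).trace) := by
  have hP := hX.isStochasticSemigroup
  have htend := hP.tendsto_integral_deviation hπ hirr
  refine ⟨hX.measurable_hitTime, fun i j => (hX.lintegral_hitTime hirr hπ i j).1,
    fun i j t _ => hX.integrable_occupationTime i j t,
    fun i j => hP.integrableOn_deviation hπ hirr i j, fun i j => ?_, fun i => ?_, fun i i' => ?_,
    fun i => hX.sum_stationary_mul_hitTime hirr hπ i⟩
  · rw [(hX.lintegral_hitTime hirr hπ i j).2]
    refine ((htend j j).sub (htend i j)).congr' ?_
    filter_upwards [eventually_ge_atTop 0] with t ht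
    rw [hX.integral_occupationTime_eq_add (π := π) j j ht,
      hX.integral_occupationTime_eq_add (π := π) i j ht, add_sub_add_right_eq_sub]
  · rw [hX.sum_stationary_mul_hitTime hirr hπ i]
    refine (tendsto_finsetSum Finset.univ fun j _ => htend j j).congr' ?_
    filter_upwards [eventually_ge_atTop 0] with t ht
    simp only [hX.integral_occupationTime_eq_add (π := π) _ _ ht, Finset.sum_add_distrib,
      ← Finset.mul_sum, hπ.sum_eq_one, mul_one, add_sub_cancel_right]
  · rw [hX.sum_stationary_mul_hitTime hirr hπ i, hX.sum_stationary_mul_hitTime hirr hπ i']
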